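/- Let $\mathfrak H$ be a separable complex Hilbert space and let $(T_t)_{t\ge 0}$ be the quantum Markov semigroup (normal, completely positive, unital, ultraweakly continuous in $t$) on the bounded operators of $\mathfrak H$ of an open quantum system with Hamiltonian $H$ and coupling operator $L$ (both possibly unbounded), so that its generator on bounded operators is $$\mathcal G(X)=-i[X,H]+L^\dagger XL-\tfrac12L^\dagger LX-\tfrac12XL^\dagger L$$ in the form sense on a common dense domain. For a normal state with density operator $\rho_0$ let $\rho_t=T_{*t}(\rho_0)$ be its evolution under the predual semigroup. For a positive self-adjoint, possibly unbounded, operator $A$ write $\langle A\rangle_\rho=\mathrm{tr}(\rho A)\in[0,\infty]$ and $\langle A(t)\rangle_{\rho_0}=\mathrm{tr}(\rho_0T_t(A))$, where the value of a normal positive functional at $A$ is its supremum over the bounded operators $0\le X\le A$. For such an $A$ we say that $A\in D(\mathcal G)$ with the self-adjoint operator $\mathcal G(A)$ if, for every state $\rho_0$ with $\langle A\rangle_{\rho_0}<\infty$ and every $t\ge 0$, the function $s\mapsto\langle \mathcal G(A)(s)\rangle_{\rho_0}$ is integrable on $[0,t]$ and $$\langle A(t)\rangle_{\rho_0}=\langle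 A\rangle_{\rho_0}+\int_0^t\langle\mathcal G(A)(s)\rangle_{\rho_0}\,ds.$$ Let $V$, $W$, $U$ be positive self-adjoint operators such that - $V\in D(\mathcal G)$, and $V$ is coercive: $V=\sum_iv_iP_i$ with eigenvalues $v_i$ and orthogonal spectral projections $P_i$, and there are a strictly increasing function $k$ with $k(i)\to\infty$ and an index $i_0$ with $v_i\ge k(i)$ for all $i>i_0$; - $W\in D(\mathcal G)$, and $\mathcal G(W)$ is bounded in the operator norm; - $\int_0^\infty\langle U(t)\rangle_{\rho_0}\,dt<\infty$ for every initial state $\rho_0$ with $\langle V\rangle_{\rho_0}<\infty$; - $\mathcal G(V)\le U-W$ in the sense of quadratic forms: every vector $\psi$ in the form domains of $\mathcal G(V)$ and of $U$ lies in the form domain of $W$ and satisfies $\langle\psi,\mathcal G(V)\psi\rangle+\langle\psi,W\psi\rangle\le\langle\psi,U\psi\rangle$. Then for every initial state $\rho_0$ with $\langle V\rangle_{\rho_0}<\infty$ one has $\langle V(t)\rangle_{\rho_0}=\langle V\rangle_{\rho_t}$ and $\langle W(t)\rangle_{\rho_0}=\langle W\rangle_{\rho_t}$ for all $t\ge0$;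 the limit $\lim_{t\to\infty}\langle V(t)\rangle_{\rho_0}=\lim_{t\to\infty}\langle V\rangle_{\rho_t}$ exists and is finite; and $$\int_0^\infty\langle W(t)\rangle_{\rho_0}\,dt=\int_0^\infty\langle W\rangle_{\rho_t}\,dt<\infty,\qquad \lim_{t\to\infty}\langle W(t)\rangle_{\rho_0}=\lim_{t\to\infty}\langle W\rangle_{\rho_t}=0 .$$ -/

import Mathlib

open scoped InnerProductSpace ENNReal NNReal Topology CStarAlgebra ComplexOrder
open Filter MeasureTheory

noncomputable section

namespace QuantumMarkov

variable {𝓗 : Type*} [NormedAddCommGroup 𝓗] [InnerProductSpace ℂ 𝓗] [CompleteSpace 𝓗]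

/-! ### States and expectations -/

/-- The trace of a positive bounded operator, `∑ᵢ ⟪eᵢ, X eᵢ⟫ ∈ [0, ∞]`, for a Hilbert basis `e`
(for positive `X` the value does not depend on the basis). -/
def posTrace (X : 𝓗 →L[ℂ] 𝓗) : ℝ≥0∞ :=
  ∑' i, ENNReal.ofReal
    (⟪(exists_hilbertBasis ℂ 𝓗).choose_spec.choose i,
      X ((exists_hilbertBasis ℂ 𝓗).choose_spec.choose i)⟫_ℂ).re

variable (𝓗) in
/-- A normal state, given by its density operator: positive and of trace one. -/
structure State where
  /-- the density operator -/
  density : 𝓗 →L[ℂ] 𝓗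
  density_nonneg : 0 ≤ density
  trace_density : posTrace density = 1

/-- The expectation `tr(ρ X) = tr(ρ^{1/2} X ρ^{1/2})` of a positive bounded operator `X`. -/
def State.expect (ρ : State 𝓗) (X : 𝓗 →L[ℂ] 𝓗) : ℝ≥0∞ :=
  posTrace (CFC.sqrt ρ.density * X * CFC.sqrt ρ.density)

/-- A positive observable: a self-adjoint, possibly unbounded, operator `A ≥ 0`. -/
def IsPosObservable (A : 𝓗 →ₗ.[ℂ] 𝓗) : Prop :=
  IsSelfAdjoint A ∧ ∀ x : A.domain, 0 ≤ (⟪(x : 𝓗), A x⟫_ℂ).re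

/-- `0 ≤ X ≤ A` for a bounded operator `X` and a positive observable `A`. -/
def IsBoundedMinorant (X : 𝓗 →L[ℂ] 𝓗) (A : 𝓗 →ₗ.[ℂ] 𝓗) : Prop :=
  0 ≤ X ∧ ∀ x : A.domain, (⟪(x : 𝓗), X x⟫_ℂ).re ≤ (⟪(x : 𝓗), A x⟫_ℂ).re

/-- The value in `[0, ∞]` of a normal positive functional `φ` at a positive observable `A`, that is
the supremum of `φ X` over the bounded operators `0 ≤ X ≤ A`. (The bounded operators
`A (1 + ε A)⁻¹` are such, and increase to `A` as `ε` decreases to `0`.) -/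
def extendToObservable (φ : (𝓗 →L[ℂ] 𝓗) → ℝ≥0∞) (A : 𝓗 →ₗ.[ℂ] 𝓗) : ℝ≥0∞ :=
  ⨆ (X : 𝓗 →L[ℂ] 𝓗) (_ : IsBoundedMinorant X A), φ X

/-- The expectation `⟨A⟩_ρ = tr(ρ A) ∈ [0, ∞]` of a positive observable. -/
def State.expectObs (ρ : State 𝓗) (A : 𝓗 →ₗ.[ℂ] 𝓗) : ℝ≥0∞ :=
  extendToObservable ρ.expect A

/-- The closed quadratic form `⟪ψ, A ψ⟫ = ‖A^{1/2} ψ‖² ∈ [0, ∞]` of a positive observable. It is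
finite exactly for `ψ` in the form domain, the domain of `A^{1/2}`. -/
def quadForm (A : 𝓗 →ₗ.[ℂ] 𝓗) (ψ : 𝓗) : ℝ≥0∞ :=
  extendToObservable (fun X => ENNReal.ofReal (⟪ψ, X ψ⟫_ℂ).re) A

/-- `P` and `N` are the positive and negative parts of the self-adjoint operator `A`: positive
observables with mutually orthogonal ranges such that `A = P - N` (with the natural domain). -/
structure IsJordanDecomp (A P N : 𝓗 →ₗ.[ℂ] 𝓗) : Prop where
  selfAdjoint : IsSelfAdjoint A
  pos : IsPosObservable P
  neg : IsPosObservable N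
  orthogonal : ∀ (x : P.domain) (y : N.domain), ⟪P x, N y⟫_ℂ = 0
  eq_sub : A = P - N

/-- The operator inequality `A ≤ U - W`, for `A` self-adjoint and positive observables `U`, `W`, in
the sense of quadratic forms: on the form domain of `U - A` (where the forms of `U` and of the two
parts of `A` are finite), `⟪ψ, A ψ⟫ + ⟪ψ, W ψ⟫ ≤ ⟪ψ, U ψ⟫`; here `A = P - N`. -/
def LeSub (A U W : 𝓗 →ₗ.[ℂ] 𝓗) : Prop :=
  ∀ P N : 𝓗 →ₗ.[ℂ] 𝓗, IsJordanDecomp A P N → ∀ ψ : 𝓗,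
    quadForm P ψ < ∞ → quadForm N ψ < ∞ → quadForm U ψ < ∞ →
      quadForm P ψ + quadForm W ψ ≤ quadForm U ψ + quadForm N ψ

/-- `V` is coercive: it has a spectral decomposition `V = ∑ᵢ vᵢ Pᵢ` whose eigenvalues satisfy
`vᵢ ≥ k i` for `i > i₀`, with `k` strictly increasing to infinity. A finite decomposition is
padded with `Pᵢ = 0`, in which case `vᵢ` is no eigenvalue and is not constrained. -/
def IsCoercive (V : 𝓗 →ₗ.[ℂ] 𝓗) : Prop :=
  ∃ (P : ℕ → 𝓗 →L[ℂ] 𝓗) (v : ℕ → ℝ),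
    (∀ i, IsStarProjection (P i)) ∧ (∀ i j, i ≠ j → P i * P j = 0) ∧
    (∀ x, HasSum (fun i => P i x) x) ∧
    (∀ x, x ∈ V.domain ↔ Summable fun i => v i ^ 2 * ‖P i x‖ ^ 2) ∧
    (∀ x : V.domain, HasSum (fun i => (v i : ℂ) • P i x) (V x)) ∧
    ∃ k : ℕ → ℝ, StrictMono k ∧ Tendsto k atTop atTop ∧
      ∃ i₀, ∀ i, i₀ < i → P i ≠ 0 → k i ≤ v i

/-! ### Quantum Markov systems -/

variable (𝓗) in
/-- The Hamiltonian `H` and the coupling operator `L` of an open quantum system, possibly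
unbounded, together with a dense domain on which `H`, `L` and `L† L` are defined. -/
structure Coefficients where
  /-- the Hamiltonian `H` -/
  ham : 𝓗 →ₗ.[ℂ] 𝓗
  ham_selfAdjoint : IsSelfAdjoint ham
  /-- the coupling operator `L` -/
  coupling : 𝓗 →ₗ.[ℂ] 𝓗
  coupling_dense : Dense (coupling.domain : Set 𝓗)
  /-- a common dense domain -/
  core : Submodule ℂ 𝓗
  core_dense : Dense (core : Set 𝓗)
  core_le_ham : core ≤ ham.domain
  core_le_coupling : core ≤ coupling.domain
  coupling_mem : ∀ u : core, coupling ⟨u, core_le_coupling u.2⟩ ∈ coupling.adjoint.domain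

namespace Coefficients

variable (c : Coefficients 𝓗)

/-- `H u` -/
def H (u : c.core) : 𝓗 := c.ham ⟨u, c.core_le_ham u.2⟩

/-- `L u` -/
def L (u : c.core) : 𝓗 := c.coupling ⟨u, c.core_le_coupling u.2⟩

/-- `L† L u` -/
def LdagL (u : c.core) : 𝓗 := c.coupling.adjoint ⟨c.L u, c.coupling_mem u⟩

/-- The matrix element `⟪u, 𝒢(X) v⟫` of the Lindblad generator
`𝒢(X) = -i [X, H] + L† X L - (1/2) L† L X - (1/2) X L† L`, for a bounded operator `X`. -/
def lindblad (X : 𝓗 →L[ℂ] 𝓗) (u v : c.core) : ℂ :=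
  -Complex.I * (⟪(u : 𝓗), X (c.H v)⟫_ℂ - ⟪c.H u, X v⟫_ℂ)
    + ⟪c.L u, X (c.L v)⟫_ℂ
    - (1 / 2) * ⟪c.LdagL u, X v⟫_ℂ - (1 / 2) * ⟪(u : 𝓗), X (c.LdagL v)⟫_ℂ

end Coefficients

variable (𝓗) in
/-- A quantum Markov system: a quantum Markov semigroup `T t`, `t ≥ 0`, of completely positive,
unital, normal maps on the bounded operators, whose generator is the Lindblad generator given by
`H` and `L`. Normality of `T t` is expressed by its predual map on states. (The values at negative
times play no role.) -/
structure System extends Coefficients 𝓗 where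
  /-- the semigroup in the Heisenberg picture -/
  T : ℝ → ((𝓗 →L[ℂ] 𝓗) →CP (𝓗 →L[ℂ] 𝓗))
  T_one : ∀ t, 0 ≤ t → T t 1 = 1
  T_zero : ∀ X, T 0 X = X
  T_add : ∀ s t, 0 ≤ s → 0 ≤ t → ∀ X, T (s + t) X = T s (T t X)
  /-- the predual semigroup `ρ ↦ ρ_t` on states, in the Schrödinger picture -/
  evolve : ℝ → State 𝓗 → State 𝓗
  expect_evolve : ∀ t, 0 ≤ t → ∀ (ρ : State 𝓗) (X : 𝓗 →L[ℂ] 𝓗), 0 ≤ X →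
    (evolve t ρ).expect X = ρ.expect (T t X)
  /-- ultraweak continuity in time -/
  continuousOn_expect : ∀ (ρ : State 𝓗) (X : 𝓗 →L[ℂ] 𝓗), 0 ≤ X →
    ContinuousOn (fun t => ρ.expect (T t X)) (Set.Ici 0)
  /-- the Lindblad equation `d/dt T_t(X) = 𝒢(T_t(X))` -/
  master_equation : ∀ (X : 𝓗 →L[ℂ] 𝓗) (u v : core) (t : ℝ), 0 ≤ t →
    HasDerivWithinAt (fun s => ⟪(u : 𝓗), T s X v⟫_ℂ) (toCoefficients.lindblad (T t X) u v)
      (Set.Ici 0) t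

namespace System

variable (S : System 𝓗)

/-- The Heisenberg picture expectation `⟨A(t)⟩_ρ = tr(ρ T_t(A)) ∈ [0, ∞]` of a positive
observable. -/
def heisenberg (ρ : State 𝓗) (A : 𝓗 →ₗ.[ℂ] 𝓗) (t : ℝ) : ℝ≥0∞ :=
  extendToObservable (fun X => ρ.expect (S.T t X)) A

/-- `V ∈ D(𝒢)` and `𝒢(V) = A`, for a positive observable `V`. The generator of the semigroup is
applied to unbounded observables in the usual integrated sense,
`T_t(V) = V + ∫₀ᵗ T_s(A) ds`, which is the Langevin equation in the mean, tested on all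
states in which `V` has finite expectation. Written with the parts `P`, `N` of `A = P - N`, so that
all terms are in `[0, ∞]`; the finiteness of the first integral is the integrability of
`s ↦ ⟨A(s)⟩_ρ` on `[0, t]`. -/
def HasGenerator (V A : 𝓗 →ₗ.[ℂ] 𝓗) : Prop :=
  IsPosObservable V ∧ ∃ P N : 𝓗 →ₗ.[ℂ] 𝓗, IsJordanDecomp A P N ∧
    ∀ ρ : State 𝓗, ρ.expectObs V < ∞ → ∀ t : ℝ, 0 ≤ t →
      ∫⁻ s in Set.Ioc 0 t, (S.heisenberg ρ P s + S.heisenberg ρ N s) < ∞ ∧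
      S.heisenberg ρ V t + ∫⁻ s in Set.Ioc 0 t, S.heisenberg ρ N s
        = ρ.expectObs V + ∫⁻ s in Set.Ioc 0 t, S.heisenberg ρ P s

end System

end QuantumMarkov

end

noncomputable section

namespace QuantumMarkov

theorem norm_add_real_smul_sq {E : Type*} [NormedAddCommGroup E] [InnerProductSpace ℂ E] (x y : E)
    (ε : ℝ) :
    ‖x + (ε : ℂ) • y‖ ^ 2 = ‖x‖ ^ 2 + 2 * ε * (⟪x, y⟫_ℂ).re + ε ^ 2 * ‖y‖ ^ 2 := by
  rw [@norm_add_sq ℂ, inner_smul_right, norm_smul, mul_pow]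
  simp
  ring

variable {𝓗 : Type*} [NormedAddCommGroup 𝓗] [InnerProductSpace ℂ 𝓗] [CompleteSpace 𝓗]

/-! ### Yosida approximation of positive observables -/

section Yosida

variable {A : 𝓗 →ₗ.[ℂ] 𝓗}

theorem IsPosObservable.inner_symm (hA : IsPosObservable A) (x y : A.domain) :
    ⟪A x, (y : 𝓗)⟫_ℂ = ⟪(x : 𝓗), A y⟫_ℂ := by
  have h := LinearPMap.adjoint_isFormalAdjoint hA.1.dense_domain
  rw [LinearPMap.isSelfAdjoint_def.1 hA.1] at h
  exact h x y

theorem IsPosObservable.inner_im (hA : IsPosObservable A) (x : A.domain) :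
    (⟪(x : 𝓗), A x⟫_ℂ).im = 0 := by
  have h := hA.inner_symm x x
  rw [← inner_conj_symm] at h
  exact Complex.conj_eq_iff_im.1 h

/-- For `ε > 0` the operator `1 + ε A` maps its domain onto the whole space, and the Yosida
approximation `A (1 + ε A)⁻¹` is bounded. -/
theorem IsPosObservable.exists_yosida (hA : IsPosObservable A) {ε : ℝ} (hε : 0 < ε) :
    ∃ Y : 𝓗 →L[ℂ] 𝓗, ∀ ψ, ∃ φ : A.domain, (φ : 𝓗) + (ε : ℂ) • A φ = ψ ∧ Y ψ = A φ := by
  have hcl : IsClosed (A.graph : Set (𝓗 × 𝓗)) := hA.1.isClosed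
  have : CompleteSpace A.graph := hcl.completeSpace_coe
  let f : A.graph →L[ℂ] 𝓗 :=
    (ContinuousLinearMap.fst ℂ 𝓗 𝓗 + (ε : ℂ) • ContinuousLinearMap.snd ℂ 𝓗 𝓗) ∘L A.graph.subtypeL
  have hf (p : A.graph) : f p = (p : 𝓗 × 𝓗).1 + (ε : ℂ) • (p : 𝓗 × 𝓗).2 := by simp [f]
  have hanti : AntilipschitzWith (1 + ⟨ε⁻¹, (inv_pos.2 hε).le⟩ : ℝ≥0) f := by
    refine ContinuousLinearMap.antilipschitz_of_bound f fun p => ?_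
    rw [hf]
    obtain ⟨⟨x, y⟩, hp⟩ := p
    obtain ⟨x, rfl, rfl⟩ := (LinearPMap.mem_graph_iff A).1 hp
    have h := norm_add_real_smul_sq (x : 𝓗) (A x) ε
    have h0 := mul_nonneg hε.le (hA.2 x)
    have h1 : ‖(x : 𝓗)‖ ≤ ‖(x : 𝓗) + (ε : ℂ) • A x‖ :=
      le_of_sq_le_sq (by nlinarith [sq_nonneg (ε * ‖A x‖)]) (norm_nonneg _)
    have h2 : ε * ‖A x‖ ≤ ‖(x : 𝓗) + (ε : ℂ) • A x‖ :=
      le_of_sq_le_sq (by nlinarith [sq_nonneg ‖(x : 𝓗)‖]) (norm_nonneg _)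
    have h3 : ‖A x‖ ≤ ε⁻¹ * ‖(x : 𝓗) + (ε : ℂ) • A x‖ := by
      rw [inv_mul_eq_div, le_div_iff₀ hε]; linarith
    have h4 : 0 ≤ ε⁻¹ * ‖(x : 𝓗) + (ε : ℂ) • A x‖ := by positivity
    change ‖((x : 𝓗), A x)‖ ≤ (1 + ε⁻¹) * ‖(x : 𝓗) + (ε : ℂ) • A x‖
    rw [Prod.norm_def]
    refine max_le ?_ ?_ <;> simp only <;> nlinarith [norm_nonneg ((x : 𝓗) + (ε : ℂ) • A x)]
  have hker : f.ker = ⊥ := LinearMap.ker_eq_bot.2 hanti.injective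
  have hclosed : IsClosed (f.range : Set 𝓗) := by
    have := hanti.isClosed_range f.uniformContinuous
    rwa [← ContinuousLinearMap.coe_coe, ← LinearMap.coe_range] at this
  have hrange : f.range = ⊤ := by
    have : CompleteSpace f.range := hclosed.completeSpace_coe
    rw [← Submodule.orthogonal_eq_bot_iff, Submodule.eq_bot_iff]
    intro y hy
    have hy' (x : A.domain) : ⟪y, (x : 𝓗)⟫_ℂ + ε * ⟪y, A x⟫_ℂ = 0 := by
      have := Submodule.inner_left_of_mem_orthogonal
        (LinearMap.mem_range_self f.toLinearMap ⟨_, A.mem_graph x⟩) hy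
      simpa [hf, inner_add_right, inner_smul_right] using this
    have hε' : (ε : ℂ) ≠ 0 := by exact_mod_cast hε.ne'
    have hw (x : A.domain) : ⟪-((ε : ℂ)⁻¹ • y), (x : 𝓗)⟫_ℂ = ⟪y, A x⟫_ℂ := by
      have := hy' x
      rw [inner_neg_left, inner_smul_left, map_inv₀, Complex.conj_ofReal]
      field_simp
      linear_combination -this
    have hmem : y ∈ A.adjoint.domain := LinearPMap.mem_adjoint_domain_of_exists y ⟨_, hw⟩
    rw [LinearPMap.isSelfAdjoint_def.1 hA.1] at hmem
    have h1 := hy' ⟨y, hmem⟩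
    have h2 := hA.2 ⟨y, hmem⟩
    have h3 := congrArg Complex.re h1
    rw [inner_self_eq_norm_sq_to_K] at h3
    have h4 : ‖y‖ ^ 2 + ε * (⟪y, A ⟨y, hmem⟩⟫_ℂ).re = 0 := by
      simpa [← Complex.ofReal_pow] using h3
    have h5 := mul_nonneg hε.le h2
    have h6 : ‖y‖ ^ 2 = 0 := le_antisymm (by linarith) (sq_nonneg _)
    simpa using h6
  let e := ContinuousLinearEquiv.ofBijective f hker hrange
  refine ⟨ContinuousLinearMap.snd ℂ 𝓗 𝓗 ∘L A.graph.subtypeL ∘L (e.symm : 𝓗 →L[ℂ] A.graph),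
    fun ψ => ?_⟩
  obtain ⟨φ, h1, h2⟩ := (LinearPMap.mem_graph_iff A).1 (e.symm ψ).2
  refine ⟨φ, ?_, by simpa using h2.symm⟩
  rw [h1, h2, ← hf]
  exact ContinuousLinearEquiv.ofBijective_apply_symm_apply f hker hrange ψ

/-- The Yosida approximation `A (1 + ε A)⁻¹` of a positive observable (for `ε > 0`). -/
def IsPosObservable.yosida (hA : IsPosObservable A) (ε : ℝ) (hε : 0 < ε) : 𝓗 →L[ℂ] 𝓗 :=
  (hA.exists_yosida hε).choose

theorem IsPosObservable.yosida_spec (hA : IsPosObservable A) {ε : ℝ} (hε : 0 < ε) (ψ : 𝓗) :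
    ∃ φ : A.domain, (φ : 𝓗) + (ε : ℂ) • A φ = ψ ∧ hA.yosida ε hε ψ = A φ :=
  (hA.exists_yosida hε).choose_spec ψ

theorem IsPosObservable.inner_yosida (hA : IsPosObservable A) {ε : ℝ} (hε : 0 < ε) (ψ : 𝓗) :
    ∃ φ : A.domain, (φ : 𝓗) + (ε : ℂ) • A φ = ψ ∧
      ⟪ψ, hA.yosida ε hε ψ⟫_ℂ
        = (((⟪(φ : 𝓗), A φ⟫_ℂ).re + ε * ‖A φ‖ ^ 2 : ℝ) : ℂ) := by
  obtain ⟨φ, h1, h2⟩ := hA.yosida_spec hε ψ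
  refine ⟨φ, h1, ?_⟩
  rw [h2, ← h1, inner_add_left, inner_smul_left, inner_self_eq_norm_sq_to_K]
  apply Complex.ext <;> simp [hA.inner_im, ← Complex.ofReal_pow]

theorem IsPosObservable.yosida_nonneg (hA : IsPosObservable A) {ε : ℝ} (hε : 0 < ε) :
    0 ≤ hA.yosida ε hε := by
  rw [ContinuousLinearMap.nonneg_iff_isPositive, ContinuousLinearMap.isPositive_iff_complex]
  intro ψ
  obtain ⟨φ, -, h⟩ := hA.inner_yosida hε ψ
  have h' := congrArg (starRingEnd ℂ) h
  rw [inner_conj_symm, Complex.conj_ofReal] at h'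
  rw [h']
  have := hA.2 φ
  simp only [RCLike.re_to_complex, Complex.ofReal_re]
  exact ⟨trivial, by positivity⟩

/-- The form of the Yosida approximation is the Moreau envelope of the form of `A`. -/
theorem IsPosObservable.re_inner_yosida_le (hA : IsPosObservable A) {ε : ℝ} (hε : 0 < ε) (ψ : 𝓗)
    (χ : A.domain) :
    (⟪ψ, hA.yosida ε hε ψ⟫_ℂ).re ≤ (⟪(χ : 𝓗), A χ⟫_ℂ).re + ‖ψ - χ‖ ^ 2 / ε := by
  obtain ⟨φ, h1, h2⟩ := hA.inner_yosida hε ψ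
  rw [h2, Complex.ofReal_re]
  obtain ⟨η, rfl⟩ : ∃ η, χ = φ + η := ⟨χ - φ, by abel⟩
  have h3 : ψ - ((φ + η : A.domain) : 𝓗) = (ε : ℂ) • A φ - η := by
    rw [← h1, Submodule.coe_add]; abel
  have h4 : ‖ψ - ((φ + η : A.domain) : 𝓗)‖ ^ 2
      = ε ^ 2 * ‖A φ‖ ^ 2 - 2 * ε * (⟪A φ, (η : 𝓗)⟫_ℂ).re + ‖(η : 𝓗)‖ ^ 2 := by
    rw [h3, @norm_sub_sq ℂ, inner_smul_left, norm_smul, mul_pow]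
    simp
    ring
  have h5 : (⟪((φ + η : A.domain) : 𝓗), A (φ + η)⟫_ℂ).re
      = (⟪(φ : 𝓗), A φ⟫_ℂ).re + 2 * (⟪A φ, (η : 𝓗)⟫_ℂ).re + (⟪(η : 𝓗), A η⟫_ℂ).re := by
    have h6 : (⟪(η : 𝓗), A φ⟫_ℂ).re = (⟪A φ, (η : 𝓗)⟫_ℂ).re := inner_re_symm (𝕜 := ℂ) _ _
    rw [LinearPMap.map_add, Submodule.coe_add, inner_add_left, inner_add_right, inner_add_right,
      ← hA.inner_symm φ η]
    simp only [Complex.add_re, h6]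
    ring
  rw [h4, h5]
  have h7 : (ε ^ 2 * ‖A φ‖ ^ 2 - 2 * ε * (⟪A φ, (η : 𝓗)⟫_ℂ).re + ‖(η : 𝓗)‖ ^ 2) / ε
      = ε * ‖A φ‖ ^ 2 - 2 * (⟪A φ, (η : 𝓗)⟫_ℂ).re + ‖(η : 𝓗)‖ ^ 2 / ε := by
    field_simp
  have h8 := hA.2 η
  have h9 : 0 ≤ ‖(η : 𝓗)‖ ^ 2 / ε := by positivity
  rw [h7]
  linarith

theorem IsPosObservable.yosida_isBoundedMinorant (hA : IsPosObservable A) {ε : ℝ} (hε : 0 < ε) :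
    IsBoundedMinorant (hA.yosida ε hε) A :=
  ⟨hA.yosida_nonneg hε, fun x => by simpa using hA.re_inner_yosida_le hε x x⟩

/-- For `ψ = (1 + ε A) φ` the Yosida approximation dominates the form of `A` at `φ` and the
squared distance between `ψ` and `φ`. -/
theorem IsPosObservable.exists_add_le_re_inner_yosida (hA : IsPosObservable A) {ε : ℝ}
    (hε : 0 < ε) (ψ : 𝓗) :
    ∃ φ : A.domain, (⟪(φ : 𝓗), A φ⟫_ℂ).re + ‖ψ - φ‖ ^ 2 / ε
      = (⟪ψ, hA.yosida ε hε ψ⟫_ℂ).re := by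
  obtain ⟨φ, h1, h2⟩ := hA.inner_yosida hε ψ
  refine ⟨φ, ?_⟩
  have h3 : ψ - (φ : 𝓗) = (ε : ℂ) • A φ := by rw [← h1]; abel
  rw [h2, h3, norm_smul, mul_pow, Complex.ofReal_re]
  simp
  field_simp

theorem IsPosObservable.re_inner_yosida_anti (hA : IsPosObservable A) {δ ε : ℝ} (hδ : 0 < δ)
    (hδε : δ ≤ ε) (ψ : 𝓗) :
    (⟪ψ, hA.yosida ε (hδ.trans_le hδε) ψ⟫_ℂ).re ≤ (⟪ψ, hA.yosida δ hδ ψ⟫_ℂ).re := by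
  obtain ⟨χ, hχ⟩ := hA.exists_add_le_re_inner_yosida hδ ψ
  rw [← hχ]
  refine (hA.re_inner_yosida_le _ ψ χ).trans ?_
  gcongr

variable (A) in
/-- The increasing sequence `A (1 + A / (n + 1))⁻¹` of bounded minorants of `A`. -/
def IsPosObservable.approx (hA : IsPosObservable A) (n : ℕ) : 𝓗 →L[ℂ] 𝓗 :=
  hA.yosida (1 / ((n : ℝ) + 1)) (by positivity)

theorem IsPosObservable.approx_isBoundedMinorant (hA : IsPosObservable A) (n : ℕ) :
    IsBoundedMinorant (hA.approx A n) A :=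
  hA.yosida_isBoundedMinorant _

theorem IsPosObservable.approx_mono (hA : IsPosObservable A) (ψ : 𝓗) :
    Monotone fun n => ENNReal.ofReal (⟪ψ, hA.approx A n ψ⟫_ℂ).re := fun m n hmn =>
  ENNReal.ofReal_le_ofReal (hA.re_inner_yosida_anti _ (by gcongr) ψ)

theorem IsPosObservable.quadForm_eq_iSup (hA : IsPosObservable A) (ψ : 𝓗) :
    quadForm A ψ = ⨆ n, ENNReal.ofReal (⟪ψ, hA.approx A n ψ⟫_ℂ).re := by
  refine le_antisymm (iSup₂_le fun X hX => ?_) (iSup_le fun n =>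
    le_iSup₂_of_le (hA.approx A n) (hA.approx_isBoundedMinorant n) le_rfl)
  set C := ⨆ n, ENNReal.ofReal (⟪ψ, hA.approx A n ψ⟫_ℂ).re with hC
  by_cases hCt : C = ∞
  · rw [hCt]; exact le_top
  have hle (n : ℕ) : (⟪ψ, hA.approx A n ψ⟫_ℂ).re ≤ C.toReal :=
    (ENNReal.ofReal_le_iff_le_toReal hCt).1 (le_iSup
      (fun n => ENNReal.ofReal (⟪ψ, hA.approx A n ψ⟫_ℂ).re) n)
  choose φ hφ using fun n : ℕ => hA.exists_add_le_re_inner_yosida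
    (ε := 1 / ((n : ℝ) + 1)) (by positivity) ψ
  have hlim : Tendsto (fun n => (φ n : 𝓗)) atTop (𝓝 ψ) := by
    have h0 : Tendsto (fun n : ℕ => C.toReal * (1 / ((n : ℝ) + 1))) atTop (𝓝 0) := by
      simpa using (tendsto_one_div_add_atTop_nhds_zero_nat (𝕜 := ℝ)).const_mul C.toReal
    have h1 : Tendsto (fun n => ‖ψ - φ n‖ ^ 2) atTop (𝓝 0) := by
      refine squeeze_zero (fun n => sq_nonneg _) (fun n => ?_) h0
      rw [← div_le_iff₀ (by positivity)]
      have := hA.2 (φ n)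
      have := hφ n
      have := hle n
      unfold IsPosObservable.approx at this
      linarith
    have h2 : Tendsto (fun n => ‖ψ - φ n‖) atTop (𝓝 0) := by
      have := h1.sqrt
      simpa using this
    rw [tendsto_iff_norm_sub_tendsto_zero]
    simpa only [norm_sub_rev] using h2
  refine (ENNReal.ofReal_le_iff_le_toReal hCt).2 ?_
  have hX' : Tendsto (fun n => (⟪(φ n : 𝓗), X (φ n)⟫_ℂ).re) atTop (𝓝 (⟪ψ, X ψ⟫_ℂ).re) :=
    (Complex.continuous_re.tendsto _).comp
      (hlim.inner ((X.continuous.tendsto ψ).comp hlim))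
  refine le_of_tendsto' hX' fun n => (hX.2 (φ n)).trans ?_
  have h1 := hφ n
  have h2 := hle n
  unfold IsPosObservable.approx at h2
  have h3 : 0 ≤ ‖ψ - φ n‖ ^ 2 / (1 / ((n : ℝ) + 1)) := by positivity
  linarith

end Yosida

/-! ### Expectations of positive observables -/

variable (𝓗) in
/-- The index type of the Hilbert basis in the definition of `posTrace`. -/
abbrev BasisIndex : Type _ := (exists_hilbertBasis ℂ 𝓗).choose

/-- The vectors `ρ^{1/2} eᵢ`. -/
def State.vec (ρ : State 𝓗) (i : BasisIndex 𝓗) : 𝓗 :=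
  CFC.sqrt ρ.density ((exists_hilbertBasis ℂ 𝓗).choose_spec.choose i)

theorem State.expect_eq_tsum (ρ : State 𝓗) (X : 𝓗 →L[ℂ] 𝓗) :
    ρ.expect X = ∑' i, ENNReal.ofReal (⟪ρ.vec i, X (ρ.vec i)⟫_ℂ).re := by
  have hsymm : (CFC.sqrt ρ.density).IsPositive :=
    (ContinuousLinearMap.nonneg_iff_isPositive _).1 (CFC.sqrt_nonneg _)
  refine tsum_congr fun i => ?_
  rw [State.vec, hsymm.inner_left_eq_inner_right]
  rfl

theorem State.expect_one (ρ : State 𝓗) : ρ.expect 1 = 1 := by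
  rw [State.expect, mul_one, CFC.sqrt_mul_sqrt_self _ ρ.density_nonneg, ρ.trace_density]

theorem State.tsum_norm_vec_sq (ρ : State 𝓗) :
    ∑' i, ENNReal.ofReal (‖ρ.vec i‖ ^ 2) = 1 := by
  rw [← ρ.expect_one, ρ.expect_eq_tsum]
  refine tsum_congr fun i => ?_
  rw [one_apply_eq_self, inner_self_eq_norm_sq_to_K]
  simp [← Complex.ofReal_pow]

theorem tsum_iSup_of_monotone {ι : Type*} {f : ι → ℕ → ℝ≥0∞} (hf : ∀ i, Monotone (f i)) :
    ∑' i, ⨆ n, f i n = ⨆ n, ∑' i, f i n := by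
  simp_rw [ENNReal.tsum_eq_iSup_sum]
  rw [iSup_comm]
  exact iSup_congr fun s => ENNReal.finsetSum_iSup_of_monotone hf

theorem State.tsum_quadForm_eq_iSup (ρ : State 𝓗) {A : 𝓗 →ₗ.[ℂ] 𝓗} (hA : IsPosObservable A) :
    ∑' i, quadForm A (ρ.vec i) = ⨆ n, ρ.expect (hA.approx A n) := by
  simp_rw [hA.quadForm_eq_iSup, ρ.expect_eq_tsum]
  exact tsum_iSup_of_monotone fun i => hA.approx_mono _

theorem State.expectObs_eq_tsum (ρ : State 𝓗) {A : 𝓗 →ₗ.[ℂ] 𝓗} (hA : IsPosObservable A) :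
    ρ.expectObs A = ∑' i, quadForm A (ρ.vec i) := by
  refine le_antisymm (iSup₂_le fun X hX => ?_) ?_
  · rw [ρ.expect_eq_tsum]
    exact ENNReal.tsum_le_tsum fun i =>
      le_iSup₂_of_le (f := fun X (_ : IsBoundedMinorant X A) =>
        ENNReal.ofReal (⟪ρ.vec i, X (ρ.vec i)⟫_ℂ).re) X hX le_rfl
  · rw [ρ.tsum_quadForm_eq_iSup hA]
    exact iSup_le fun n => le_iSup₂_of_le (hA.approx A n) (hA.approx_isBoundedMinorant n) le_rfl

theorem State.expectObs_eq_iSup (ρ : State 𝓗) {A : 𝓗 →ₗ.[ℂ] 𝓗} (hA : IsPosObservable A) :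
    ρ.expectObs A = ⨆ n, ρ.expect (hA.approx A n) := by
  rw [ρ.expectObs_eq_tsum hA, ρ.tsum_quadForm_eq_iSup hA]

theorem State.expectObs_add_le (ρ : State 𝓗) {A P N U W : 𝓗 →ₗ.[ℂ] 𝓗} (h : IsJordanDecomp A P N)
    (hU : IsPosObservable U) (hW : IsPosObservable W) (hle : LeSub A U W)
    (hP' : ρ.expectObs P ≠ ∞) (hN' : ρ.expectObs N ≠ ∞) (hU' : ρ.expectObs U ≠ ∞) :
    ρ.expectObs P + ρ.expectObs W ≤ ρ.expectObs U + ρ.expectObs N := by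
  have hP := h.pos
  have hN := h.neg
  rw [ρ.expectObs_eq_tsum hP] at hP' ⊢
  rw [ρ.expectObs_eq_tsum hN] at hN' ⊢
  rw [ρ.expectObs_eq_tsum hU] at hU' ⊢
  rw [ρ.expectObs_eq_tsum hW, ← ENNReal.tsum_add, ← ENNReal.tsum_add]
  exact ENNReal.tsum_le_tsum fun i => hle P N h _
    (ENNReal.ne_top_of_tsum_ne_top hP' i).lt_top (ENNReal.ne_top_of_tsum_ne_top hN' i).lt_top
    (ENNReal.ne_top_of_tsum_ne_top hU' i).lt_top

/-! ### Observables bounded in norm -/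

theorem IsSelfAdjoint.domain_eq_top_of_bounded {A : 𝓗 →ₗ.[ℂ] 𝓗} (hA : IsSelfAdjoint A) {R : ℝ}
    (hR : ∀ x : A.domain, ‖A x‖ ≤ R * ‖(x : 𝓗)‖) : A.domain = ⊤ := by
  rw [Submodule.eq_top_iff']
  intro y
  rw [← LinearPMap.isSelfAdjoint_def.1 hA, LinearPMap.mem_adjoint_domain_iff]
  have hc : Continuous A.toFun := (A.toFun.mkContinuous R hR).continuous
  exact (innerSL ℂ y).continuous.comp hc

theorem expectObs_le_of_bounded {A : 𝓗 →ₗ.[ℂ] 𝓗} (hA : A.domain = ⊤)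
    {R : ℝ} (hR : ∀ x : A.domain, ‖A x‖ ≤ R * ‖(x : 𝓗)‖) (ρ : State 𝓗) :
    ρ.expectObs A ≤ ENNReal.ofReal R := by
  refine iSup₂_le fun X hX => ?_
  rw [ρ.expect_eq_tsum, ← mul_one (ENNReal.ofReal R), ← ρ.tsum_norm_vec_sq, ← ENNReal.tsum_mul_left]
  refine ENNReal.tsum_le_tsum fun i => ?_
  rw [← ENNReal.ofReal_mul' (sq_nonneg _)]
  refine ENNReal.ofReal_le_ofReal ?_
  have hmem : ρ.vec i ∈ A.domain := hA ▸ Submodule.mem_top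
  refine (hX.2 ⟨_, hmem⟩).trans ((Complex.re_le_norm _).trans ((norm_inner_le_norm _ _).trans ?_))
  have := mul_le_mul_of_nonneg_left (hR ⟨_, hmem⟩) (norm_nonneg (ρ.vec i))
  linarith

theorem IsJordanDecomp.norm_sq {A P N : 𝓗 →ₗ.[ℂ] 𝓗} (h : IsJordanDecomp A P N) {x : 𝓗}
    (hx : x ∈ A.domain) (hP : x ∈ P.domain) (hN : x ∈ N.domain) :
    ‖A ⟨x, hx⟩‖ ^ 2 = ‖P ⟨x, hP⟩‖ ^ 2 + ‖N ⟨x, hN⟩‖ ^ 2 := by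
  obtain rfl := h.eq_sub
  rw [LinearPMap.sub_apply, @norm_sub_sq ℂ, h.orthogonal]
  simp

theorem IsJordanDecomp.expectObs_le {A P N : 𝓗 →ₗ.[ℂ] 𝓗} (h : IsJordanDecomp A P N) {R : ℝ}
    (hR : ∀ x : A.domain, ‖A x‖ ≤ R * ‖(x : 𝓗)‖) (ρ : State 𝓗) :
    ρ.expectObs P ≤ ENNReal.ofReal R ∧ ρ.expectObs N ≤ ENNReal.ofReal R := by
  have htop := IsSelfAdjoint.domain_eq_top_of_bounded h.selfAdjoint hR
  have hinf : P.domain ⊓ N.domain = ⊤ := by rw [← htop, h.eq_sub, LinearPMap.sub_domain]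
  obtain ⟨hP, hN⟩ := inf_eq_top_iff.1 hinf
  have key (x : 𝓗) : ‖P ⟨x, hP ▸ Submodule.mem_top⟩‖ ≤ R * ‖x‖ ∧
      ‖N ⟨x, hN ▸ Submodule.mem_top⟩‖ ≤ R * ‖x‖ := by
    have h1 := h.norm_sq (x := x) (htop ▸ Submodule.mem_top) (hP ▸ Submodule.mem_top)
      (hN ▸ Submodule.mem_top)
    have h2 := hR ⟨x, htop ▸ Submodule.mem_top⟩
    exact ⟨(le_of_sq_le_sq (by nlinarith [sq_nonneg ‖N ⟨x, hN ▸ Submodule.mem_top⟩‖])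
      (norm_nonneg _)).trans h2, (le_of_sq_le_sq
        (by nlinarith [sq_nonneg ‖P ⟨x, hP ▸ Submodule.mem_top⟩‖]) (norm_nonneg _)).trans h2⟩
  exact ⟨expectObs_le_of_bounded hP (fun x => (key x).1) ρ,
    expectObs_le_of_bounded hN (fun x => (key x).2) ρ⟩

/-! ### Heisenberg and Schrödinger pictures -/

namespace System

variable (S : System 𝓗)

theorem T_nonneg {t : ℝ} {X : 𝓗 →L[ℂ] 𝓗} (hX : 0 ≤ X) : 0 ≤ S.T t X := by
  simpa using OrderHomClass.mono (S.T t) hX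

theorem heisenberg_eq (ρ : State 𝓗) (A : 𝓗 →ₗ.[ℂ] 𝓗) {t : ℝ} (ht : 0 ≤ t) :
    S.heisenberg ρ A t = (S.evolve t ρ).expectObs A :=
  iSup_congr fun X => iSup_congr fun hX => (S.expect_evolve t ht ρ X hX.1).symm

theorem heisenberg_zero (ρ : State 𝓗) (A : 𝓗 →ₗ.[ℂ] 𝓗) :
    S.heisenberg ρ A 0 = ρ.expectObs A := by
  simp only [heisenberg, State.expectObs, S.T_zero]

theorem heisenberg_evolve (ρ : State 𝓗) (A : 𝓗 →ₗ.[ℂ] 𝓗) {s t : ℝ} (hs : 0 ≤ s) (ht : 0 ≤ t) :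
    S.heisenberg (S.evolve s ρ) A t = S.heisenberg ρ A (s + t) := by
  refine iSup_congr fun X => iSup_congr fun hX => ?_
  simp only [S.expect_evolve s hs ρ _ (S.T_nonneg hX.1), S.T_add s t hs ht]

theorem aemeasurable_heisenberg (ρ : State 𝓗) {A : 𝓗 →ₗ.[ℂ] 𝓗} (hA : IsPosObservable A) :
    AEMeasurable (S.heisenberg ρ A) (volume.restrict (Set.Ici 0)) := by
  have h : AEMeasurable (fun t => ⨆ n, ρ.expect (S.T t (hA.approx A n)))
      (volume.restrict (Set.Ici 0)) := AEMeasurable.iSup fun n =>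
    (S.continuousOn_expect ρ _ (hA.approx_isBoundedMinorant n).1).aemeasurable measurableSet_Ici
  refine h.congr ?_
  filter_upwards [ae_restrict_mem measurableSet_Ici] with t ht
  rw [S.heisenberg_eq ρ A ht, State.expectObs_eq_iSup _ hA]
  exact iSup_congr fun n => (S.expect_evolve t ht ρ _ (hA.approx_isBoundedMinorant n).1).symm

end System

end QuantumMarkov

end

/-! ### Integrals over half-lines -/

theorem setLIntegral_Ioc_add_Ioi (u : ℝ → ℝ≥0∞) {s t : ℝ} (hst : s ≤ t) :
    (∫⁻ r in Set.Ioc s t, u r) + ∫⁻ r in Set.Ioi t, u r = ∫⁻ r in Set.Ioi s, u r := by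
  rw [← lintegral_union measurableSet_Ioi (Set.Ioc_disjoint_Ioi le_rfl),
    Set.Ioc_union_Ioi_eq_Ioi hst]

theorem setLIntegral_Ioc_add_Ioc (u : ℝ → ℝ≥0∞) {r s t : ℝ} (hrs : r ≤ s) (hst : s ≤ t) :
    (∫⁻ x in Set.Ioc r s, u x) + ∫⁻ x in Set.Ioc s t, u x = ∫⁻ x in Set.Ioc r t, u x := by
  rw [← lintegral_union measurableSet_Ioc (Set.Ioc_disjoint_Ioc_of_le le_rfl),
    Set.Ioc_union_Ioc_eq_Ioc hrs hst]

theorem tendsto_setLIntegral_Ioi_atTop {u : ℝ → ℝ≥0∞} {a : ℝ}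
    (hu : ∫⁻ r in Set.Ioi a, u r ≠ ∞) :
    Tendsto (fun t => ∫⁻ r in Set.Ioi t, u r) atTop (𝓝 0) := by
  set ν := (volume.restrict (Set.Ioi a)).withDensity u with hν
  have hνt (t : ℝ) (ht : a ≤ t) : ν (Set.Ioi t) = ∫⁻ r in Set.Ioi t, u r := by
    rw [hν, withDensity_apply _ measurableSet_Ioi, Measure.restrict_restrict measurableSet_Ioi,
      Set.inter_eq_left.2 (Set.Ioi_subset_Ioi ht)]
  have h := tendsto_measure_iInter_atTop (μ := ν) (s := fun t : ℝ => Set.Ioi t)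
    (fun t => measurableSet_Ioi.nullMeasurableSet) (fun s t hst => Set.Ioi_subset_Ioi hst)
    ⟨a, by rwa [hνt a le_rfl]⟩
  have hempty : ⋂ t : ℝ, Set.Ioi t = ∅ := by
    ext x
    simpa using ⟨x, le_rfl⟩
  rw [hempty, measure_empty] at h
  exact h.congr' ((eventually_ge_atTop a).mono hνt)

/-- A function whose increments are bounded by the integrals of an integrable function converges. -/
theorem exists_tendsto_of_le_add_setLIntegral {u v : ℝ → ℝ≥0∞}
    (hu : ∫⁻ r in Set.Ioi 0, u r ≠ ∞) (hv : v 0 ≠ ∞)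
    (h : ∀ s t, 0 ≤ s → s ≤ t → v t ≤ v s + ∫⁻ r in Set.Ioc s t, u r) :
    ∃ ℓ : ℝ≥0, Tendsto v atTop (𝓝 (ℓ : ℝ≥0∞)) := by
  set f : ℝ → ℝ≥0∞ := fun t => v (max t 0) + ∫⁻ r in Set.Ioi (max t 0), u r with hf
  have hanti : Antitone f := fun s t hst => by
    have hst' : max s 0 ≤ max t 0 := max_le_max_right 0 hst
    calc f t ≤ v (max s 0) + (∫⁻ r in Set.Ioc (max s 0) (max t 0), u r)
          + ∫⁻ r in Set.Ioi (max t 0), u r := 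
            add_le_add (h _ _ (le_max_right _ _) hst') le_rfl
      _ = f s := by rw [add_assoc, setLIntegral_Ioc_add_Ioi u hst']
  have hne : (⨅ t, f t) ≠ ∞ := ne_top_of_le_ne_top (ENNReal.add_ne_top.2 ⟨hv, hu⟩)
    (by simpa [hf] using iInf_le f 0)
  refine ⟨(⨅ t, f t).toNNReal, ?_⟩
  rw [ENNReal.coe_toNNReal hne]
  have h1 := ENNReal.Tendsto.sub (tendsto_atTop_iInf hanti) (tendsto_setLIntegral_Ioi_atTop hu)
    (Or.inl hne)
  rw [tsub_zero] at h1
  refine h1.congr' ((eventually_ge_atTop 0).mono fun t ht => ?_)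
  simp only [hf, max_eq_left ht]
  refine ENNReal.add_sub_cancel_right (ne_top_of_le_ne_top hu ?_)
  exact lintegral_mono_set (Set.Ioi_subset_Ioi ht)

/-- An integrable function on a half-line which decreases at bounded speed at most tends to `0`. -/
theorem tendsto_zero_of_setLIntegral_ne_top {w : ℝ → ℝ≥0∞} {a : ℝ} {R : ℝ≥0}
    (hw : ∫⁻ r in Set.Ioi a, w r ≠ ∞)
    (h : ∀ s t, a ≤ s → s ≤ t → w s ≤ w t + R * ENNReal.ofReal (t - s)) :
    Tendsto w atTop (𝓝 0) := by
  have key (s δ : ℝ) (hs : a ≤ s) (hδ : 0 < δ) :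
      w s ≤ (∫⁻ r in Set.Ioi s, w r) / ENNReal.ofReal δ + R * ENNReal.ofReal δ := by
    have hδ0 : ENNReal.ofReal δ ≠ 0 := (ENNReal.ofReal_pos.2 hδ).ne'
    have h1 : w s * ENNReal.ofReal δ
        ≤ ∫⁻ r in Set.Ioc s (s + δ), (w r + R * ENNReal.ofReal δ) := by
      have h2 : ∫⁻ _ in Set.Ioc s (s + δ), w s = w s * ENNReal.ofReal δ := by
        rw [setLIntegral_const, Real.volume_Ioc, add_sub_cancel_left]
      rw [← h2]
      refine setLIntegral_mono' measurableSet_Ioc fun r hr => (h s r hs hr.1.le).trans ?_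
      gcongr
      linarith [hr.2]
    rw [lintegral_add_right _ measurable_const, setLIntegral_const, Real.volume_Ioc,
      add_sub_cancel_left] at h1
    have h3 := ENNReal.div_le_div_right h1 (ENNReal.ofReal δ)
    rw [ENNReal.add_div, ENNReal.mul_div_cancel_right hδ0 ENNReal.ofReal_ne_top,
      ENNReal.mul_div_cancel_right hδ0 ENNReal.ofReal_ne_top] at h3
    refine h3.trans ?_
    gcongr
    exact Set.Ioc_subset_Ioi_self
  rw [ENNReal.tendsto_nhds_zero]
  intro ε hε
  obtain ⟨δ, hδ, hδε⟩ : ∃ δ : ℝ, 0 < δ ∧ R * ENNReal.ofReal δ ≤ ε / 2 := by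
    by_cases hεt : ε = ∞
    · exact ⟨1, one_pos, by simp [hεt, ENNReal.top_div]⟩
    have hpos : 0 < ε.toReal := ENNReal.toReal_pos hε.ne' hεt
    refine ⟨ε.toReal / (2 * (R + 1)), by positivity, ?_⟩
    rw [← ENNReal.ofReal_coe_nnreal, ← ENNReal.ofReal_mul R.coe_nonneg, ← ENNReal.ofReal_toReal hεt,
      ← ENNReal.ofReal_ofNat, ← ENNReal.ofReal_div_of_pos two_pos,
      ENNReal.toReal_ofReal hpos.le]
    refine ENNReal.ofReal_le_ofReal ?_
    have hR : (0 : ℝ) ≤ R := R.2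
    rw [mul_div_assoc', div_le_div_iff₀ (by positivity) two_pos]
    nlinarith
  have hlim : Tendsto (fun s => (∫⁻ r in Set.Ioi s, w r) / ENNReal.ofReal δ) atTop (𝓝 0) := by
    have := ENNReal.Tendsto.div_const (tendsto_setLIntegral_Ioi_atTop hw)
      (b := ENNReal.ofReal δ) (Or.inr (ENNReal.ofReal_pos.2 hδ).ne')
    simpa using this
  filter_upwards [eventually_ge_atTop a,
    (ENNReal.tendsto_nhds_zero.1 hlim) (ε / 2) (ENNReal.half_pos hε.ne')] with s hs hs'
  calc w s ≤ _ := key s δ hs hδ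
    _ ≤ ε / 2 + ε / 2 := add_le_add hs' hδε
    _ = ε := ENNReal.add_halves ε

namespace QuantumMarkov

variable {𝓗 : Type*} [NormedAddCommGroup 𝓗] [InnerProductSpace ℂ 𝓗] [CompleteSpace 𝓗]

/-! ### Dissipation of observables -/

namespace System

variable (S : System 𝓗)

/-- The integrated generator equation between two times. -/
theorem HasGenerator.exists_increment {S : System 𝓗} {V A : 𝓗 →ₗ.[ℂ] 𝓗} (h : S.HasGenerator V A) :
    ∃ P N : 𝓗 →ₗ.[ℂ] 𝓗, IsJordanDecomp A P N ∧ ∀ ρ : State 𝓗, ρ.expectObs V < ∞ →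
      ∀ s t : ℝ, 0 ≤ s → s ≤ t →
        ∫⁻ r in Set.Ioc s t, S.heisenberg ρ P r ≠ ∞ ∧ ∫⁻ r in Set.Ioc s t, S.heisenberg ρ N r ≠ ∞ ∧
        S.heisenberg ρ V t + ∫⁻ r in Set.Ioc s t, S.heisenberg ρ N r
          = S.heisenberg ρ V s + ∫⁻ r in Set.Ioc s t, S.heisenberg ρ P r := by
  obtain ⟨-, P, N, hJ, h⟩ := h
  refine ⟨P, N, hJ, fun ρ hρ s t hs hst => ?_⟩
  have hfin := (h ρ hρ t (hs.trans hst)).1.ne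
  have hP : ∫⁻ r in Set.Ioc 0 t, S.heisenberg ρ P r ≠ ∞ :=
    ne_top_of_le_ne_top hfin (lintegral_mono fun _ => le_self_add)
  have hN : ∫⁻ r in Set.Ioc 0 t, S.heisenberg ρ N r ≠ ∞ :=
    ne_top_of_le_ne_top hfin (lintegral_mono fun _ => le_add_self)
  have ht := (h ρ hρ t (hs.trans hst)).2
  have hs' := (h ρ hρ s hs).2
  rw [← setLIntegral_Ioc_add_Ioc _ hs hst] at hP hN
  rw [← setLIntegral_Ioc_add_Ioc _ hs hst, ← setLIntegral_Ioc_add_Ioc _ hs hst, ← add_assoc,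
    ← add_assoc, ← hs', add_right_comm, add_right_comm (S.heisenberg ρ V s)] at ht
  rw [ENNReal.add_ne_top] at hP hN
  exact ⟨hP.2, hN.2, (ENNReal.add_left_inj hN.1).1 ht⟩

theorem ae_ne_top_heisenberg (ρ : State 𝓗) {A : 𝓗 →ₗ.[ℂ] 𝓗} (hA : IsPosObservable A) {s : Set ℝ}
    (hs : s ⊆ Set.Ici 0) (h : ∫⁻ r in s, S.heisenberg ρ A r ≠ ∞) :
    ∀ᵐ r ∂volume.restrict s, S.heisenberg ρ A r ≠ ∞ :=
  (ae_lt_top' ((S.aemeasurable_heisenberg ρ hA).mono_set hs) h).mono fun _ hr => hr.ne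

/-- If `𝒢(V) ≤ U - W`, then `⟨V(t)⟩ + ∫ₛᵗ ⟨W(r)⟩ dr ≤ ⟨V(s)⟩ + ∫ₛᵗ ⟨U(r)⟩ dr`. -/
theorem HasGenerator.add_setLIntegral_le {S : System 𝓗} {V A U W : 𝓗 →ₗ.[ℂ] 𝓗}
    (h : S.HasGenerator V A) (hU : IsPosObservable U) (hW : IsPosObservable W) (hle : LeSub A U W)
    {ρ : State 𝓗} (hρ : ρ.expectObs V < ∞) {s t : ℝ} (hs : 0 ≤ s) (hst : s ≤ t)
    (hUfin : ∫⁻ r in Set.Ioc s t, S.heisenberg ρ U r ≠ ∞) :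
    S.heisenberg ρ V t + ∫⁻ r in Set.Ioc s t, S.heisenberg ρ W r
      ≤ S.heisenberg ρ V s + ∫⁻ r in Set.Ioc s t, S.heisenberg ρ U r := by
  obtain ⟨P, N, hJ, h⟩ := h.exists_increment
  obtain ⟨hP, hN, heq⟩ := h ρ hρ s t hs hst
  have hsub : Set.Ioc s t ⊆ Set.Ici 0 := fun r hr => hs.trans hr.1.le
  have hint : (∫⁻ r in Set.Ioc s t, S.heisenberg ρ P r) + ∫⁻ r in Set.Ioc s t, S.heisenberg ρ W r
      ≤ (∫⁻ r in Set.Ioc s t, S.heisenberg ρ U r) + ∫⁻ r in Set.Ioc s t, S.heisenberg ρ N r := by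
    rw [← lintegral_add_left' ((S.aemeasurable_heisenberg ρ hJ.pos).mono_set hsub),
      ← lintegral_add_left' ((S.aemeasurable_heisenberg ρ hU).mono_set hsub)]
    refine lintegral_mono_ae ?_
    filter_upwards [S.ae_ne_top_heisenberg ρ hJ.pos hsub hP, S.ae_ne_top_heisenberg ρ hJ.neg hsub hN,
      S.ae_ne_top_heisenberg ρ hU hsub hUfin, ae_restrict_mem measurableSet_Ioc]
      with r hPr hNr hUr hr
    rw [S.heisenberg_eq ρ _ (hsub hr)] at hPr hNr hUr
    simp only [S.heisenberg_eq ρ _ (hsub hr)]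
    exact (S.evolve r ρ).expectObs_add_le hJ hU hW hle hPr hNr hUr
  refine (ENNReal.add_le_add_iff_right hN).1 ?_
  calc _ = S.heisenberg ρ V t + (∫⁻ r in Set.Ioc s t, S.heisenberg ρ N r)
        + ∫⁻ r in Set.Ioc s t, S.heisenberg ρ W r := add_right_comm _ _ _
    _ = S.heisenberg ρ V s + ((∫⁻ r in Set.Ioc s t, S.heisenberg ρ P r)
        + ∫⁻ r in Set.Ioc s t, S.heisenberg ρ W r) := by rw [heq, add_assoc]
    _ ≤ S.heisenberg ρ V s + ((∫⁻ r in Set.Ioc s t, S.heisenberg ρ U r)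
        + ∫⁻ r in Set.Ioc s t, S.heisenberg ρ N r) := by gcongr
    _ = _ := (add_assoc _ _ _).symm

/-- An observable with bounded generator decreases at bounded speed at most. -/
theorem HasGenerator.heisenberg_le_add {S : System 𝓗} {W A : 𝓗 →ₗ.[ℂ] 𝓗} (h : S.HasGenerator W A)
    {R : ℝ} (hR : ∀ x : A.domain, ‖A x‖ ≤ R * ‖(x : 𝓗)‖) {ρ : State 𝓗} (hρ : ρ.expectObs W < ∞)
    {s t : ℝ} (hs : 0 ≤ s) (hst : s ≤ t) :
    S.heisenberg ρ W s ≤ S.heisenberg ρ W t + R.toNNReal * ENNReal.ofReal (t - s) := by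
  obtain ⟨P, N, hJ, h⟩ := h.exists_increment
  calc S.heisenberg ρ W s ≤ S.heisenberg ρ W t + ∫⁻ r in Set.Ioc s t, S.heisenberg ρ N r := by
        rw [(h ρ hρ s t hs hst).2.2]; exact le_self_add
    _ ≤ S.heisenberg ρ W t + ∫⁻ _ in Set.Ioc s t, ENNReal.ofReal R := by
        gcongr 1
        refine setLIntegral_mono' measurableSet_Ioc fun r hr => ?_
        rw [S.heisenberg_eq ρ N (hs.trans hr.1.le)]
        exact (hJ.expectObs_le hR _).2
    _ = _ := by rw [setLIntegral_const, Real.volume_Ioc]; rfl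

theorem HasGenerator.setLIntegral_Ioi_ne_top {S : System 𝓗} {V A U W : 𝓗 →ₗ.[ℂ] 𝓗}
    (h : S.HasGenerator V A) (hU : IsPosObservable U) (hW : IsPosObservable W) (hle : LeSub A U W)
    {ρ : State 𝓗} (hρ : ρ.expectObs V < ∞)
    (hUfin : ∫⁻ r in Set.Ioi 0, S.heisenberg ρ U r ≠ ∞) :
    ∫⁻ r in Set.Ioi 0, S.heisenberg ρ W r ≠ ∞ := by
  have hsub (t : ℝ) : ∫⁻ r in Set.Ioc 0 t, S.heisenberg ρ U r
      ≤ ∫⁻ r in Set.Ioi 0, S.heisenberg ρ U r := lintegral_mono_set Set.Ioc_subset_Ioi_self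
  have hbound (n : ℕ) : ∫⁻ r in Set.Ioc (0 : ℝ) n, S.heisenberg ρ W r
      ≤ ρ.expectObs V + ∫⁻ r in Set.Ioi 0, S.heisenberg ρ U r := by
    have := h.add_setLIntegral_le hU hW hle hρ le_rfl n.cast_nonneg
      (ne_top_of_le_ne_top hUfin (hsub n))
    rw [S.heisenberg_zero] at this
    exact (le_add_self.trans this).trans (add_le_add le_rfl (hsub n))
  have hunion : Set.Ioi (0 : ℝ) = ⋃ n : ℕ, Set.Ioc (0 : ℝ) n := by
    ext x
    simpa using fun _ => exists_nat_ge x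
  rw [hunion, setLIntegral_iUnion_of_directed]
  · exact ne_top_of_le_ne_top (ENNReal.add_ne_top.2 ⟨hρ.ne, hUfin⟩) (iSup_le hbound)
  · exact (show Monotone fun n : ℕ => Set.Ioc (0 : ℝ) n from fun m n hmn =>
      Set.Ioc_subset_Ioc_right (by exact_mod_cast hmn)).directed_le

end System

end QuantumMarkov

theorem corollary1 {𝓗 : Type*} [NormedAddCommGroup 𝓗] [InnerProductSpace ℂ 𝓗] [CompleteSpace 𝓗]
    [TopologicalSpace.SeparableSpace 𝓗] (S : QuantumMarkov.System 𝓗)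
    (V W U GV GW : 𝓗 →ₗ.[ℂ] 𝓗)
    (hV : QuantumMarkov.IsPosObservable V)
    (hVcoercive : QuantumMarkov.IsCoercive V)
    (hGV : S.HasGenerator V GV)
    (hW : QuantumMarkov.IsPosObservable W)
    (hGW : S.HasGenerator W GW)
    (hGWbounded : ∃ R : ℝ, ∀ x : GW.domain, ‖GW x‖ ≤ R * ‖(x : 𝓗)‖)
    (hU : QuantumMarkov.IsPosObservable U)
    (hUintegral : ∀ ρ₀ : QuantumMarkov.State 𝓗, ρ₀.expectObs V < ∞ →
      ∫⁻ t in Set.Ioi (0 : ℝ), S.heisenberg ρ₀ U t < ∞)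
    (hle : QuantumMarkov.LeSub GV U W)
    (ρ₀ : QuantumMarkov.State 𝓗) (hρ₀ : ρ₀.expectObs V < ∞) :
    (∀ t : ℝ, 0 ≤ t → S.heisenberg ρ₀ V t = (S.evolve t ρ₀).expectObs V) ∧
    (∀ t : ℝ, 0 ≤ t → S.heisenberg ρ₀ W t = (S.evolve t ρ₀).expectObs W) ∧
    (∃ ℓ : ℝ≥0, Tendsto (fun t : ℝ => S.heisenberg ρ₀ V t) atTop (𝓝 (ℓ : ℝ≥0∞)) ∧
      Tendsto (fun t : ℝ => (S.evolve t ρ₀).expectObs V) atTop (𝓝 (ℓ : ℝ≥0∞))) ∧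
    (∫⁻ t in Set.Ioi (0 : ℝ), S.heisenberg ρ₀ W t
      = ∫⁻ t in Set.Ioi (0 : ℝ), (S.evolve t ρ₀).expectObs W) ∧
    ∫⁻ t in Set.Ioi (0 : ℝ), S.heisenberg ρ₀ W t < ∞ ∧
    Tendsto (fun t : ℝ => S.heisenberg ρ₀ W t) atTop (𝓝 0) ∧
    Tendsto (fun t : ℝ => (S.evolve t ρ₀).expectObs W) atTop (𝓝 0) := by
  have hVeq (t : ℝ) (ht : 0 ≤ t) : S.heisenberg ρ₀ V t = (S.evolve t ρ₀).expectObs V :=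
    S.heisenberg_eq ρ₀ V ht
  have hWeq (t : ℝ) (ht : 0 ≤ t) : S.heisenberg ρ₀ W t = (S.evolve t ρ₀).expectObs W :=
    S.heisenberg_eq ρ₀ W ht
  have hUfin := (hUintegral ρ₀ hρ₀).ne
  have hWfin := hGV.setLIntegral_Ioi_ne_top hU hW hle hρ₀ hUfin
  obtain ⟨ℓ, hℓ⟩ := exists_tendsto_of_le_add_setLIntegral hUfin
    (by rw [S.heisenberg_zero]; exact hρ₀.ne) fun s t hs hst =>
      le_self_add.trans (hGV.add_setLIntegral_le hU hW hle hρ₀ hs hst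
        (ne_top_of_le_ne_top hUfin (lintegral_mono_set
          (Set.Ioc_subset_Ioi_self.trans (Set.Ioi_subset_Ioi hs)))))
  obtain ⟨a, ha, haW⟩ : ∃ a : ℝ, 0 < a ∧ S.heisenberg ρ₀ W a ≠ ∞ := by
    have hae := S.ae_ne_top_heisenberg ρ₀ hW Set.Ioi_subset_Ici_self hWfin
    have : NeBot (ae (volume.restrict (Set.Ioi (0 : ℝ)))) := by
      rw [ae_neBot, Ne, Measure.restrict_eq_zero, Real.volume_Ioi]
      exact ENNReal.top_ne_zero
    obtain ⟨a, haW, ha⟩ := (hae.and (ae_restrict_mem measurableSet_Ioi)).exists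
    exact ⟨a, ha, haW⟩
  obtain ⟨R, hR⟩ := hGWbounded
  have hlim : Tendsto (fun t : ℝ => S.heisenberg ρ₀ W t) atTop (𝓝 0) := by
    refine tendsto_zero_of_setLIntegral_ne_top (a := a) (R := R.toNNReal)
      (ne_top_of_le_ne_top hWfin (lintegral_mono_set (Set.Ioi_subset_Ioi ha.le)))
      fun s t hs hst => ?_
    have hρa : (S.evolve a ρ₀).expectObs W < ∞ := by rw [← hWeq a ha.le]; exact haW.lt_top
    have h := hGW.heisenberg_le_add hR hρa (sub_nonneg.2 hs) (sub_le_sub_right hst a)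
    rwa [S.heisenberg_evolve _ _ ha.le (sub_nonneg.2 hs),
      S.heisenberg_evolve _ _ ha.le (sub_nonneg.2 (hs.trans hst)), add_sub_cancel,
      add_sub_cancel, sub_sub_sub_cancel_right] at h
  exact ⟨hVeq, hWeq, ⟨ℓ, hℓ, hℓ.congr' ((eventually_ge_atTop 0).mono hVeq)⟩,
    setLIntegral_congr_fun measurableSet_Ioi fun t ht => hWeq t (le_of_lt ht), hWfin.lt_top, hlim,
    hlim.congr' ((eventually_ge_atTop 0).mono hWeq)⟩
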